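/- Let $M=(|M|,\mathcal O_M)$ be a supermanifold of dimension $m|n$, i.e. a second countable Hausdorff space with a sheaf of supercommutative $\mathbb Z_2$-graded real algebras (with local stalks) that is locally isomorphic to $(U, C^\infty_U\otimes\bigwedge\mathbb R^n)$, $U\subset\mathbb R^m$ open. Let $\mathrm{Vect}(M)$ be the left $\mathcal O_M(|M|)$-module of superderivations of $\mathcal O_M(|M|)$, with the supercommutator $[X,Y]=XY-(-1)^{|X||Y|}YX$; here and below $|\cdot|\in\mathbb Z_2$ is the parity, and formulas with signs are for homogeneous elements and are extended additively. Let $g$ be a Riemannian metric on $M$: a morphism of sheaves $\mathcal TM\otimes\mathcal TM\to\mathcal O_M$ that is homogeneous of some parity $|g|\in\mathbb Z_2$ (so $|g(X,Y)|=|X|+|Y|+|g|$), $\mathcal O_M$-linear ($g(fX,Y)=f\,g(X,Y)$), graded symmetric ($g(X,Y)=(-1)^{|X||Y|}g(Y,X)$) and non-degenerate (if $g(X,Y)=0$ for all $Y$, then $X=0$). An affine connection is a parity-preserving biadditive map $(X,Y)\mapsto\nabla_XY$ on $\mathrm{Vect}(M)$ with $\nabla_{fX}Y=f\nabla_XY$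 and $\nabla_X(fY)=X(f)Y+(-1)^{|X||f|}f\nabla_XY$; its curvature is $$R_\nabla(X,Y)Z=\nabla_X\nabla_YZ-(-1)^{|X||Y|}\nabla_Y\nabla_XZ-\nabla_{[X,Y]}Z .$$ Let $\nabla^L$ be the Levi-Civita connection of $g$, i.e. the affine connection with $\nabla^L_XY-(-1)^{|X||Y|}\nabla^L_YX=[X,Y]$ and $X\,g(Y,Z)=g(\nabla^L_XY,Z)+(-1)^{|X||Y|}g(Y,\nabla^L_XZ)$, and let $R^L$ be its curvature. Let $P\in\mathrm{Vect}(M)$ be homogeneous with $|g|+|P|=0$, put $\pi(Z)=g(Z,P)$, and let $\widehat\nabla$ be the semi-symmetric non-metric connection $$\widehat\nabla_XY=\nabla^L_XY+(-1)^{|X||Y|}g(Y,P)X .$$ Then $\pi$ is an even one-form, i.e. $|\pi(Z)|=|Z|$, and for all homogeneous $X,Y,Z\in\mathrm{Vect}(M)$ $$\begin{aligned}R_{\widehat\nabla}(X,Y)Z={}&R^L(X,Y)Z+(-1)^{(|X|+|Y|)|Z|}\bigl[g(Z,\nabla^L_XP)Y-(-1)^{|X||Y|}g(Z,\nabla^L_YP)X\bigr]\\&+(-1)^{(|X|+|Y|)|Z|}\pi(Z)\bigl[(-1)^{|X||Y|}\pi(Y)X-\pi(X)Y\bigr].\end{aligned}$$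 -/

import Mathlib

open CategoryTheory TopologicalSpace Opposite
open scoped Manifold ContDiff TensorProduct

noncomputable section

/-! ### Superalgebras and their derivations -/

/-- The sign `(-1)^i` of a parity `i`. -/
def paritySign (i : ZMod 2) : ℤ := (-1) ^ i.val

theorem paritySign_aux : ∀ i j k : ZMod 2,
    paritySign (i * k) * paritySign (j * k) = paritySign ((j + i) * k) := by
  decide

/-- `ab = (-1)^{|a||b|} ba` for homogeneous `a`, `b`. -/
class SuperCommutative {A : Type*} [Ring A] [Algebra ℝ A] (𝒜 : ZMod 2 → Submodule ℝ A) : Prop where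
  comm : ∀ {i j : ZMod 2} {a b : A}, a ∈ 𝒜 i → b ∈ 𝒜 j → a * b = paritySign (i * j) • (b * a)

section Superalgebra

variable {A : Type*} [Ring A] [Algebra ℝ A] (𝒜 : ZMod 2 → Submodule ℝ A)

/-- Superderivations of degree `i`:
`D(ab) = D(a)b + (-1)^{i|a|} a D(b)` and `|D(a)| = i + |a|`. -/
def superDer (i : ZMod 2) : Submodule ℝ (Module.End ℝ A) where
  carrier := {D | (∀ j, ∀ a ∈ 𝒜 j, D a ∈ 𝒜 (i + j)) ∧
    ∀ j, ∀ a ∈ 𝒜 j, ∀ b, D (a * b) = D a * b + paritySign (i * j) • (a * D b)}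
  add_mem' := by
    rintro D E ⟨hD, hD'⟩ ⟨hE, hE'⟩
    refine ⟨fun j a ha => (𝒜 _).add_mem (hD j a ha) (hE j a ha), fun j a ha b => ?_⟩
    simp only [LinearMap.add_apply, hD' j a ha b, hE' j a ha b, add_mul, mul_add, smul_add]
    abel
  zero_mem' := ⟨fun j a _ => by simp, fun j a _ b => by simp⟩
  smul_mem' := by
    rintro c D ⟨hD, hD'⟩
    refine ⟨fun j a ha => (𝒜 _).smul_mem c (hD j a ha), fun j a ha b => ?_⟩
    simp only [LinearMap.smul_apply, hD' j a ha b, smul_add, smul_mul_assoc, mul_smul_comm,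
      smul_comm c]

variable {𝒜} in
theorem superBracket_mem {i j : ZMod 2} {D E : Module.End ℝ A} (hD : D ∈ superDer 𝒜 i)
    (hE : E ∈ superDer 𝒜 j) : D * E - paritySign (i * j) • (E * D) ∈ superDer 𝒜 (i + j) := by
  refine ⟨fun k a ha => ?_, fun k a ha b => ?_⟩
  · refine (𝒜 _).sub_mem ?_ ?_
    · have := hD.1 _ _ (hE.1 k a ha); rwa [← add_assoc] at this
    · have := hE.1 _ _ (hD.1 k a ha)
      rw [← add_assoc, add_comm j] at this
      exact zsmul_mem this _
  · simp only [LinearMap.sub_apply, LinearMap.smul_apply, Module.End.mul_apply, hD.2 k a ha,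
      hE.2 k a ha, map_add, map_zsmul, hD.2 _ _ (hE.1 k a ha), hE.2 _ _ (hD.1 k a ha)]
    generalize D a * E b = p
    generalize E a * D b = q
    rw [sub_mul, mul_sub, smul_mul_assoc, mul_smul_comm]
    have : ∀ i : ZMod 2, i = 0 ∨ i = 1 := by decide
    have h1 : (1 + 1 : ZMod 2) = 0 := by decide
    have h2 : paritySign 0 = 1 := by decide
    have h3 : paritySign 1 = -1 := by decide
    rcases this i with rfl | rfl <;> rcases this j with rfl | rfl <;>
      rcases this k with rfl | rfl <;> simp [h1, h2, h3] <;> abel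

variable [GradedAlgebra 𝒜]

/-- The component of degree `i` of a linear endomorphism of a superalgebra. -/
def homPart (i : ZMod 2) : Module.End ℝ A →ₗ[ℝ] Module.End ℝ A where
  toFun D := ∑ j : ZMod 2, GradedAlgebra.proj 𝒜 (i + j) ∘ₗ D ∘ₗ GradedAlgebra.proj 𝒜 j
  map_add' D E := by
    simp only [LinearMap.add_comp, LinearMap.comp_add, Finset.sum_add_distrib]
  map_smul' c D := by
    simp only [LinearMap.smul_comp, LinearMap.comp_smul, Finset.smul_sum, RingHom.id_apply]

variable {𝒜}

theorem proj_of_mem {i : ZMod 2} {a : A} (ha : a ∈ 𝒜 i) (j : ZMod 2) :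
    GradedAlgebra.proj 𝒜 j a = if i = j then a else 0 := by
  rw [GradedAlgebra.proj_apply]
  split_ifs with h
  · subst h; exact DirectSum.decompose_of_mem_same 𝒜 ha
  · exact DirectSum.decompose_of_mem_ne 𝒜 ha h

theorem proj_mem (i : ZMod 2) (a : A) : GradedAlgebra.proj 𝒜 i a ∈ 𝒜 i := by
  rw [GradedAlgebra.proj_apply]; exact SetLike.coe_mem _

theorem sum_proj (a : A) : ∑ i : ZMod 2, GradedAlgebra.proj 𝒜 i a = a := by
  classical
  conv_rhs => rw [← DirectSum.sum_support_decompose 𝒜 a]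
  symm
  refine Finset.sum_subset (Finset.subset_univ _) fun i _ hi => ?_
  simpa using hi

theorem end_ext_hom {D E : Module.End ℝ A} (h : ∀ j, ∀ a ∈ 𝒜 j, D a = E a) : D = E := by
  ext a
  rw [← sum_proj (𝒜 := 𝒜) a, map_sum, map_sum]
  exact Finset.sum_congr rfl fun i _ => h i _ (proj_mem i a)

theorem homPart_apply (i : ZMod 2) (D : Module.End ℝ A) {j : ZMod 2} {a : A} (ha : a ∈ 𝒜 j) :
    homPart 𝒜 i D a = GradedAlgebra.proj 𝒜 (i + j) (D a) := by
  simp only [homPart, LinearMap.coe_mk, AddHom.coe_mk, LinearMap.sum_apply, LinearMap.comp_apply,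
    proj_of_mem ha]
  rw [Finset.sum_eq_single j]
  · simp
  · intro k _ hk; simp [Ne.symm hk]
  · simp

theorem sum_homPart (D : Module.End ℝ A) : ∑ i, homPart 𝒜 i D = D := by
  refine end_ext_hom (𝒜 := 𝒜) fun j a ha => ?_
  simp only [LinearMap.sum_apply, homPart_apply _ _ ha]
  conv_rhs => rw [← sum_proj (𝒜 := 𝒜) (D a)]
  exact Fintype.sum_equiv (Equiv.addRight j) _ _ fun i => rfl

theorem homPart_of_mem {i : ZMod 2} {D : Module.End ℝ A} (hD : D ∈ superDer 𝒜 i) (j : ZMod 2) :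
    homPart 𝒜 j D = if i = j then D else 0 := by
  refine end_ext_hom (𝒜 := 𝒜) fun k a ha => ?_
  rw [homPart_apply _ _ ha, proj_of_mem (hD.1 k a ha)]
  by_cases h : i = j <;> simp [h]

theorem smul_mem_superDer [SuperCommutative 𝒜] {i j : ZMod 2} {f : A} (hf : f ∈ 𝒜 j)
    {D : Module.End ℝ A} (hD : D ∈ superDer 𝒜 i) : f • D ∈ superDer 𝒜 (j + i) := by
  refine ⟨fun k a ha => ?_, fun k a ha b => ?_⟩
  · rw [add_assoc]; exact SetLike.mul_mem_graded hf (hD.1 k a ha)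
  · simp only [LinearMap.smul_apply, smul_eq_mul, hD.2 k a ha b, mul_add, mul_assoc, mul_smul_comm]
    congr 1
    rw [← mul_assoc, SuperCommutative.comm hf ha, ← mul_assoc, smul_mul_assoc, smul_smul]
    congr 1
    exact paritySign_aux i j k

theorem homPart_smul {j : ZMod 2} {f : A} (hf : f ∈ 𝒜 j) (i : ZMod 2) (D : Module.End ℝ A) :
    homPart 𝒜 (j + i) (f • D) = f • homPart 𝒜 i D := by
  refine end_ext_hom (𝒜 := 𝒜) fun k a ha => ?_
  rw [homPart_apply _ _ ha, LinearMap.smul_apply, LinearMap.smul_apply, homPart_apply _ _ ha,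
    smul_eq_mul, smul_eq_mul, add_assoc, GradedAlgebra.proj_apply, GradedAlgebra.proj_apply]
  exact DirectSum.coe_decompose_mul_add_of_left_mem 𝒜 hf

variable (𝒜)

/-- The left `A`-module `Der(A)` of superderivations of a supercommutative algebra: the linear
endomorphisms whose homogeneous components are superderivations. -/
def superDerModule [SuperCommutative 𝒜] : Submodule A (Module.End ℝ A) where
  carrier := {D | ∀ i, homPart 𝒜 i D ∈ superDer 𝒜 i}
  add_mem' := by
    intro D E hD hE i
    rw [map_add]; exact (superDer 𝒜 i).add_mem (hD i) (hE i)
  zero_mem' := by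
    intro i; rw [map_zero]; exact (superDer 𝒜 i).zero_mem
  smul_mem' := by
    intro f D hD i
    rw [← sum_proj (𝒜 := 𝒜) f, Finset.sum_smul, map_sum]
    refine Submodule.sum_mem _ fun j _ => ?_
    have h := smul_mem_superDer (proj_mem (𝒜 := 𝒜) j f) (hD (i - j))
    rw [← homPart_smul (proj_mem j f), add_sub_cancel] at h
    exact h

/-- The type of superderivations. -/
def SuperDer [SuperCommutative 𝒜] : Type _ := superDerModule 𝒜

instance [SuperCommutative 𝒜] : AddCommGroup (SuperDer 𝒜) :=
  inferInstanceAs (AddCommGroup (superDerModule 𝒜))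

instance [SuperCommutative 𝒜] : Module A (SuperDer 𝒜) :=
  inferInstanceAs (Module A (superDerModule 𝒜))

variable {𝒜} in
/-- A superderivation as a linear endomorphism. -/
def SuperDer.toEnd [SuperCommutative 𝒜] : SuperDer 𝒜 →ₗ[A] Module.End ℝ A :=
  (superDerModule 𝒜).subtype

variable {𝒜} in
theorem SuperDer.ext_toEnd [SuperCommutative 𝒜] {X Y : SuperDer 𝒜} (h : X.toEnd = Y.toEnd) :
    X = Y :=
  Subtype.ext h

variable {𝒜} [SuperCommutative 𝒜]

theorem mem_superDerModule {i : ZMod 2} {D : Module.End ℝ A} (hD : D ∈ superDer 𝒜 i) :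
    D ∈ superDerModule 𝒜 := by
  intro j
  rw [homPart_of_mem hD]
  split_ifs with h
  · exact h ▸ hD
  · exact (superDer 𝒜 j).zero_mem

namespace SuperDer

/-- `X` is homogeneous of parity `i`. (The zero derivation has both parities.) -/
def HasParity (X : SuperDer 𝒜) (i : ZMod 2) : Prop := X.toEnd ∈ superDer 𝒜 i

/-- The homogeneous component of parity `i`. -/
def part (i : ZMod 2) (X : SuperDer 𝒜) : SuperDer 𝒜 :=
  ⟨homPart 𝒜 i X.toEnd, mem_superDerModule (X.2 i)⟩

/-- The supercommutator, `[X, Y] = XY - (-1)^{|X||Y|} YX` for homogeneous `X`, `Y`,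
extended biadditively. -/
def bracket (X Y : SuperDer 𝒜) : SuperDer 𝒜 :=
  ∑ i : ZMod 2, ∑ j : ZMod 2,
    ⟨(part i X).toEnd * (part j Y).toEnd -
      paritySign (i * j) • ((part j Y).toEnd * (part i X).toEnd),
      mem_superDerModule (superBracket_mem (X.2 i) (Y.2 j))⟩

/-- The right multiplication, `X · f = (-1)^{|X||f|} f X` for homogeneous `X`, `f`,
extended biadditively. -/
def rightMul (X : SuperDer 𝒜) (f : A) : SuperDer 𝒜 :=
  ∑ i : ZMod 2, ∑ j : ZMod 2, paritySign (i * j) • (GradedAlgebra.proj 𝒜 j f • part i X)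

theorem part_of_hasParity {X : SuperDer 𝒜} {i : ZMod 2} (hX : X.HasParity i) (j : ZMod 2) :
    part j X = if i = j then X else 0 := by
  apply ext_toEnd
  change homPart 𝒜 j X.toEnd = _
  rw [homPart_of_mem hX]
  split_ifs <;> rfl

theorem sum_part (X : SuperDer 𝒜) : ∑ i, part i X = X := by
  apply ext_toEnd
  rw [map_sum]
  exact sum_homPart (𝒜 := 𝒜) X.toEnd

theorem part_add (i : ZMod 2) (X Y : SuperDer 𝒜) : part i (X + Y) = part i X + part i Y :=
  ext_toEnd (map_add (homPart 𝒜 i) _ _)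

theorem rightMul_add_left (X Y : SuperDer 𝒜) (f : A) :
    rightMul (X + Y) f = rightMul X f + rightMul Y f := by
  simp only [rightMul, part_add, smul_add, Finset.sum_add_distrib]

theorem rightMul_add_right (X : SuperDer 𝒜) (f h : A) :
    rightMul X (f + h) = rightMul X f + rightMul X h := by
  simp only [rightMul, map_add, add_smul, smul_add, Finset.sum_add_distrib]

theorem rightMul_of_hasParity {X : SuperDer 𝒜} {i j : ZMod 2} {f : A} (hX : X.HasParity i)
    (hf : f ∈ 𝒜 j) : rightMul X f = paritySign (i * j) • (f • X) := by
  unfold rightMul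
  rw [Finset.sum_eq_single i, Finset.sum_eq_single j]
  · rw [part_of_hasParity hX, if_pos rfl, proj_of_mem hf, if_pos rfl]
  · intro k _ hk
    rw [proj_of_mem hf, if_neg (Ne.symm hk), zero_smul, smul_zero]
  · exact fun h => absurd (Finset.mem_univ _) h
  · intro k _ hk
    refine Finset.sum_eq_zero fun l _ => ?_
    rw [part_of_hasParity hX, if_neg (Ne.symm hk), smul_zero, smul_zero]
  · exact fun h => absurd (Finset.mem_univ _) h

theorem HasParity.smul {X : SuperDer 𝒜} {i j : ZMod 2} {f : A} (hf : f ∈ 𝒜 j)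
    (hX : X.HasParity i) : (f • X).HasParity (j + i) :=
  smul_mem_superDer hf hX

theorem hasParity_part (X : SuperDer 𝒜) (i : ZMod 2) : (part i X).HasParity i := X.2 i

theorem HasParity.add {X Y : SuperDer 𝒜} {i : ZMod 2} (hX : X.HasParity i)
    (hY : Y.HasParity i) : (X + Y).HasParity i :=
  (superDer 𝒜 i).add_mem hX hY

theorem HasParity.zsmul {X : SuperDer 𝒜} {i : ZMod 2} (hX : X.HasParity i) (k : ℤ) :
    (k • X).HasParity i := by
  change (k • X).toEnd ∈ superDer 𝒜 i
  rw [map_zsmul]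
  exact zsmul_mem (S := Submodule ℝ (Module.End ℝ A)) hX k

theorem rightMul_zero_left (f : A) : rightMul (0 : SuperDer 𝒜) f = 0 := by
  simpa using rightMul_add_left (0 : SuperDer 𝒜) 0 f

theorem rightMul_zero_right (X : SuperDer 𝒜) : rightMul X 0 = 0 := by
  simpa using rightMul_add_right X 0 0

theorem rightMul_sum_left {ι : Type*} (s : Finset ι) (X : ι → SuperDer 𝒜) (f : A) :
    rightMul (∑ i ∈ s, X i) f = ∑ i ∈ s, rightMul (X i) f :=
  map_sum (AddMonoidHom.mk' (fun X : SuperDer 𝒜 => rightMul X f)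
    fun X Y => rightMul_add_left X Y f) X s

theorem rightMul_sum_right {ι : Type*} (s : Finset ι) (X : SuperDer 𝒜) (f : ι → A) :
    rightMul X (∑ i ∈ s, f i) = ∑ i ∈ s, rightMul X (f i) :=
  map_sum (AddMonoidHom.mk' (fun f : A => rightMul X f) fun f h => rightMul_add_right X f h) f s

theorem rightMul_smul (h : A) (X : SuperDer 𝒜) (f : A) :
    rightMul (h • X) f = h • rightMul X f := by
  have key : ∀ i j k, rightMul (GradedAlgebra.proj 𝒜 i h • part k X) (GradedAlgebra.proj 𝒜 j f) =
      GradedAlgebra.proj 𝒜 i h • rightMul (part k X) (GradedAlgebra.proj 𝒜 j f) := by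
    intro i j k
    have hi := proj_mem (𝒜 := 𝒜) i h
    have hj := proj_mem (𝒜 := 𝒜) j f
    rw [rightMul_of_hasParity (HasParity.smul hi (hasParity_part X k)) hj,
      rightMul_of_hasParity (hasParity_part X k) hj, smul_comm (GradedAlgebra.proj 𝒜 i h),
      smul_smul (GradedAlgebra.proj 𝒜 i h), SuperCommutative.comm hi hj, smul_assoc, smul_smul,
      smul_smul]
    congr 1
    exact (by decide : ∀ i j k : ZMod 2,
      paritySign ((i + k) * j) = paritySign (k * j) * paritySign (i * j)) i j k
  calc rightMul (h • X) f
      = ∑ i, ∑ k, ∑ j, rightMul (GradedAlgebra.proj 𝒜 i h • part k X)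
          (GradedAlgebra.proj 𝒜 j f) := by
        conv_lhs => rw [← sum_proj (𝒜 := 𝒜) h, ← sum_proj (𝒜 := 𝒜) f, ← sum_part X]
        simp_rw [Finset.sum_smul, Finset.smul_sum, rightMul_sum_left, rightMul_sum_right]
    _ = ∑ i, GradedAlgebra.proj 𝒜 i h • rightMul X f := by
        refine Finset.sum_congr rfl fun i _ => ?_
        conv_rhs => rw [← sum_proj (𝒜 := 𝒜) f, ← sum_part X]
        simp_rw [rightMul_sum_left, rightMul_sum_right, Finset.smul_sum, key]
    _ = h • rightMul X f := by rw [← Finset.sum_smul, sum_proj]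

theorem rightMul_mul {X : SuperDer 𝒜} {i j : ZMod 2} {f : A} (hX : X.HasParity i) (hf : f ∈ 𝒜 j)
    (h : A) : rightMul X (f * h) = paritySign (i * j) • (f • rightMul X h) := by
  rw [← sum_proj (𝒜 := 𝒜) h]
  simp only [Finset.mul_sum, rightMul_sum_right, Finset.smul_sum]
  refine Finset.sum_congr rfl fun k _ => ?_
  have hk := proj_mem (𝒜 := 𝒜) k h
  rw [rightMul_of_hasParity hX (SetLike.mul_mem_graded hf hk), rightMul_of_hasParity hX hk,
    smul_comm f, smul_smul, smul_smul]
  congr 1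
  exact (by decide : ∀ i j k : ZMod 2,
    paritySign (i * (j + k)) = paritySign (i * j) * paritySign (i * k)) i j k

end SuperDer

variable (𝒜)

/-- An affine connection on the vector fields `Der(A)`. -/
structure AffineConnection where
  toFun : SuperDer 𝒜 → SuperDer 𝒜 → SuperDer 𝒜
  hasParity : ∀ {i j : ZMod 2} {X Y : SuperDer 𝒜}, X.HasParity i → Y.HasParity j →
    (toFun X Y).HasParity (i + j)
  add_left : ∀ X Y Z, toFun (X + Y) Z = toFun X Z + toFun Y Z
  add_right : ∀ X Y Z, toFun X (Y + Z) = toFun X Y + toFun X Z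
  smul_left : ∀ (f : A) X Y, toFun (f • X) Y = f • toFun X Y
  leibniz : ∀ {i j : ZMod 2} {X : SuperDer 𝒜} {f : A}, X.HasParity i → f ∈ 𝒜 j →
    ∀ Y, toFun X (f • Y) =
      X.toEnd f • Y + paritySign (i * j) • (f • toFun X Y)

instance : CoeFun (AffineConnection 𝒜) fun _ => SuperDer 𝒜 → SuperDer 𝒜 → SuperDer 𝒜 :=
  ⟨AffineConnection.toFun⟩

/-- A homogeneous, graded symmetric, non-degenerate `A`-bilinear pairing of degree `d`
on `Der(A)`. -/
structure SuperMetric (d : ZMod 2) where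
  toFun : SuperDer 𝒜 → SuperDer 𝒜 → A
  degree : ∀ {i j : ZMod 2} {X Y : SuperDer 𝒜}, X.HasParity i → Y.HasParity j →
    toFun X Y ∈ 𝒜 (i + j + d)
  add_left : ∀ X Y Z, toFun (X + Y) Z = toFun X Z + toFun Y Z
  add_right : ∀ X Y Z, toFun X (Y + Z) = toFun X Y + toFun X Z
  smul_left : ∀ (f : A) X Y, toFun (f • X) Y = f * toFun X Y
  symm : ∀ {i j : ZMod 2} {X Y : SuperDer 𝒜}, X.HasParity i → Y.HasParity j →
    toFun X Y = paritySign (i * j) • toFun Y X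
  nondegenerate : ∀ X, (∀ Y, toFun X Y = 0) → X = 0

instance (d : ZMod 2) : CoeFun (SuperMetric 𝒜 d) fun _ => SuperDer 𝒜 → SuperDer 𝒜 → A :=
  ⟨SuperMetric.toFun⟩

variable {𝒜}

namespace AffineConnection

/-- `T(X, Y) = ∇_X Y - (-1)^{|X||Y|} ∇_Y X - [X, Y]` for homogeneous `X`, `Y`,
extended biadditively. -/
def torsion (D : AffineConnection 𝒜) (X Y : SuperDer 𝒜) : SuperDer 𝒜 :=
  ∑ i : ZMod 2, ∑ j : ZMod 2, (D (X.part i) (Y.part j) -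
    paritySign (i * j) • D (Y.part j) (X.part i) - (X.part i).bracket (Y.part j))

/-- `R(X, Y)Z = ∇_X ∇_Y Z - (-1)^{|X||Y|} ∇_Y ∇_X Z - ∇_{[X, Y]} Z` for homogeneous `X`, `Y`,
extended biadditively. -/
def curvature (D : AffineConnection 𝒜) (X Y Z : SuperDer 𝒜) : SuperDer 𝒜 :=
  ∑ i : ZMod 2, ∑ j : ZMod 2, (D (X.part i) (D (Y.part j) Z) -
    paritySign (i * j) • D (Y.part j) (D (X.part i) Z) - D ((X.part i).bracket (Y.part j)) Z)

/-- `X⟨Y, Z⟩ = ⟨∇_X Y, Z⟩ + (-1)^{|X||Y|} ⟨Y, ∇_X Z⟩`. -/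
def MetricCompatible (D : AffineConnection 𝒜) {d : ZMod 2} (g : SuperMetric 𝒜 d) : Prop :=
  ∀ {i j : ZMod 2} {X Y : SuperDer 𝒜}, X.HasParity i → Y.HasParity j → ∀ Z,
    X.toEnd (g Y Z) = g (D X Y) Z + paritySign (i * j) • g Y (D X Z)

/-- The Levi-Civita connection: symmetric (torsionless) and metric compatible. -/
structure IsLeviCivita (D : AffineConnection 𝒜) {d : ZMod 2} (g : SuperMetric 𝒜 d) : Prop where
  torsion_eq_zero : ∀ X Y, D.torsion X Y = 0
  metricCompatible : D.MetricCompatible g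

end AffineConnection

/-- The one-form `π(Z) = g(Z, P)`. -/
def SuperMetric.oneForm {d : ZMod 2} (g : SuperMetric 𝒜 d) (P : SuperDer 𝒜) :
    SuperDer 𝒜 →ₗ[A] A where
  toFun Z := g Z P
  map_add' X Y := g.add_left X Y P
  map_smul' f X := g.smul_left f X P

theorem SuperMetric.oneForm_mem {d p : ZMod 2} (g : SuperMetric 𝒜 d) {P : SuperDer 𝒜}
    (hP : P.HasParity p) (hdp : d + p = 0) {i : ZMod 2} {X : SuperDer 𝒜} (hX : X.HasParity i) :
    g X P ∈ 𝒜 i := by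
  have h := g.degree hX hP
  rwa [add_assoc, add_comm p d, hdp, add_zero] at h

/-- The semi-symmetric non-metric connection `∇̂_X Y = ∇_X Y + X · g(Y, P)`, which is
`∇_X Y + (-1)^{|X||Y|} g(Y, P) X` for homogeneous `X`, `Y`; here `|g| + |P| = 0`. -/
def semiSymmetricNonMetric (D : AffineConnection 𝒜) {d p : ZMod 2} (g : SuperMetric 𝒜 d)
    (P : SuperDer 𝒜) (hP : P.HasParity p) (hdp : d + p = 0) : AffineConnection 𝒜 where
  toFun X Y := D X Y + X.rightMul (g Y P)
  hasParity := by
    intro i j X Y hX hY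
    refine (D.hasParity hX hY).add ?_
    have hg := g.oneForm_mem hP hdp hY
    rw [SuperDer.rightMul_of_hasParity hX hg, add_comm i j]
    exact (SuperDer.HasParity.smul hg hX).zsmul _
  add_left X Y Z := by
    rw [D.add_left, SuperDer.rightMul_add_left]; abel
  add_right X Y Z := by
    rw [D.add_right, g.add_left, SuperDer.rightMul_add_right]; abel
  smul_left f X Y := by
    rw [D.smul_left, smul_add, SuperDer.rightMul_smul]
  leibniz := by
    intro i j X f hX hf Y
    rw [D.leibniz hX hf, smul_add, smul_add, g.smul_left, add_assoc,
      SuperDer.rightMul_mul hX hf]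

end Superalgebra

/-! ### Supermanifolds -/

/-- `C^∞(W)` for an open subset `W` of `ℝ^m`. -/
abbrev SmoothFun {m : ℕ} (W : Opens (EuclideanSpace ℝ (Fin m))) : Type :=
  C^∞⟮𝓘(ℝ, EuclideanSpace ℝ (Fin m)), W; 𝓘(ℝ, ℝ), ℝ⟯

/-- Restriction of smooth functions. -/
def SmoothFun.restrict {m : ℕ} {V W : Opens (EuclideanSpace ℝ (Fin m))} (h : V ≤ W) :
    SmoothFun W →ₐ[ℝ] SmoothFun V :=
  { ContMDiffMap.restrictRingHom 𝓘(ℝ, EuclideanSpace ℝ (Fin m)) 𝓘(ℝ, ℝ) ℝ h with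
    commutes' := fun _ => rfl }

/-- Sections `C^∞(W) ⊗ ⋀ ℝ^n` of the structure sheaf of the standard superdomain `W^{m|n}`. -/
abbrev SuperdomainFun {m : ℕ} (n : ℕ) (W : Opens (EuclideanSpace ℝ (Fin m))) : Type :=
  SmoothFun W ⊗[ℝ] ExteriorAlgebra ℝ (Fin n → ℝ)

/-- Restriction maps of the standard superdomain. -/
def SuperdomainFun.restrict {m : ℕ} (n : ℕ) {V W : Opens (EuclideanSpace ℝ (Fin m))} (h : V ≤ W) :
    SuperdomainFun n W →ₐ[ℝ] SuperdomainFun n V :=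
  Algebra.TensorProduct.map (SmoothFun.restrict h) (AlgHom.id ℝ _)

/-- The part of parity `i` of `C^∞(W) ⊗ ⋀ ℝ^n`, namely `C^∞(W) ⊗ (⋀ ℝ^n)_i`. (The exterior
algebra is the Clifford algebra of the zero form, and `evenOdd` is its `ℤ/2`-grading.) -/
def SuperdomainFun.grading {m : ℕ} (n : ℕ) (W : Opens (EuclideanSpace ℝ (Fin m))) (i : ZMod 2) :
    Submodule ℝ (SuperdomainFun n W) :=
  LinearMap.range (LinearMap.lTensor (SmoothFun W)
    (CliffordAlgebra.evenOdd (0 : QuadraticForm ℝ (Fin n → ℝ)) i).subtype)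

universe u

/-- A locally `ℤ/2`-ringed space: a second countable Hausdorff space with a sheaf of
supercommutative real algebras whose stalks are local rings. -/
structure LocallySuperRingedSpace where
  carrier : TopCat.{u}
  t2 : T2Space carrier
  secondCountable : SecondCountableTopology carrier
  sheaf : TopCat.Sheaf (AlgCat.{u} ℝ) carrier
  /-- The homogeneous sections over `U`. -/
  grading : ∀ U : Opens carrier, ZMod 2 → Submodule ℝ (sheaf.presheaf.obj (op U))
  gradedAlgebra : ∀ U, GradedAlgebra (grading U)
  superCommutative : ∀ U, SuperCommutative (grading U)
  map_mem_grading : ∀ {U V : Opens carrier} (h : V ≤ U) (i : ZMod 2),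
    ∀ s ∈ grading U i, (sheaf.presheaf.map (homOfLE h).op).hom s ∈ grading V i
  isLocalRing_stalk : ∀ p : carrier, IsLocalRing
    (TopCat.Presheaf.stalk (C := RingCat.{u}) (sheaf.presheaf ⋙ forget₂ (AlgCat.{u} ℝ) RingCat.{u}) p)

namespace LocallySuperRingedSpace

variable (S : LocallySuperRingedSpace.{u})

/-- The algebra `𝒪(U)` of sections over `U`. -/
abbrev Fun (U : Opens S.carrier) : Type u := S.sheaf.presheaf.obj (op U)

instance (U : Opens S.carrier) : GradedAlgebra (S.grading U) := S.gradedAlgebra U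

instance (U : Opens S.carrier) : SuperCommutative (S.grading U) := S.superCommutative U

/-- Restriction of sections. -/
def res {U V : Opens S.carrier} (h : V ≤ U) : S.Fun U →ₐ[ℝ] S.Fun V :=
  (S.sheaf.presheaf.map (homOfLE h).op).hom

/-- Sections over `U` of the tangent sheaf, `Der(𝒪(U))`. -/
abbrev Vect (U : Opens S.carrier) : Type u := SuperDer (S.grading U)

/-- The vector field `X'` on `V` is the restriction of the vector field `X` on `U`. -/
def IsRestriction {U V : Opens S.carrier} (h : V ≤ U) (X : S.Vect U) (X' : S.Vect V) : Prop :=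
  ∀ f : S.Fun U, S.res h (X.toEnd f) =
    X'.toEnd (S.res h f)

/-- An isomorphism of an open subspace of `S` with an open subspace of the standard superdomain
`ℝ^{m|n}`: a homeomorphism `toHomeo` of open subsets of the underlying spaces, with isomorphisms
of superalgebras between sections over corresponding open sets which commute with restrictions. -/
structure Chart (m n : ℕ) where
  toHomeo : OpenPartialHomeomorph S.carrier (EuclideanSpace ℝ (Fin m))
  iso : ∀ W : Opens (EuclideanSpace ℝ (Fin m)), (W : Set _) ⊆ toHomeo.target →
    S.Fun ⟨toHomeo.source ∩ toHomeo ⁻¹' W, toHomeo.isOpen_inter_preimage W.isOpen⟩ ≃ₐ[ℝ]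
      SuperdomainFun n W
  iso_mem_grading : ∀ W hW i f, f ∈ S.grading _ i → iso W hW f ∈ SuperdomainFun.grading n W i
  iso_res : ∀ V W hV hW (h : V ≤ W) f,
    iso V hV (S.res (Set.inter_subset_inter_right _ (Set.preimage_mono h)) f) =
      SuperdomainFun.restrict n h (iso W hW f)

end LocallySuperRingedSpace

/-- A supermanifold of dimension `m|n`. -/
structure Supermanifold (m n : ℕ) extends LocallySuperRingedSpace.{u} where
  exists_chart : ∀ p : carrier, ∃ c : toLocallySuperRingedSpace.Chart m n, p ∈ c.toHomeo.source

/-- A (homogeneous) Riemannian metric on a supermanifold, that is, a morphism of sheaves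
`𝒯M ⊗ 𝒯M → 𝒪_M` given by pairings on sections over open sets, compatible with restrictions. -/
structure SuperRiemannianMetric {m n : ℕ} (M : Supermanifold.{u} m n) where
  /-- The parity `|g|`. -/
  parity : ZMod 2
  onOpen : ∀ U : Opens M.carrier, SuperMetric (M.grading U) parity
  restrict : ∀ {U V : Opens M.carrier} (h : V ≤ U) (X Y : M.Vect U) (X' Y' : M.Vect V),
    M.IsRestriction h X X' → M.IsRestriction h Y Y' →
      M.res h (onOpen U X Y) = onOpen V X' Y'

/-- The metric on global vector fields. -/
abbrev SuperRiemannianMetric.globally {m n : ℕ} {M : Supermanifold.{u} m n}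
    (g : SuperRiemannianMetric M) : SuperMetric (M.grading ⊤) g.parity := g.onOpen ⊤

end

/-!
Write `X · f = (-1)^{|X||f|} f X` for the right action of functions on vector fields. Connections
satisfy a Leibniz rule for this action, and an even one-form `π` satisfies `π(X · f) = π(X) f`.
Hence, if `∇̂_X Y = ∇_X Y + X · π(Y)`, then, for all `Z` and with no sign depending on `|Z|`,
`R̂(X, Y)Z = R(X, Y)Z + T(X, Y) · π(Z) + (-1)^{|X||Y|} Y · (∇_X π)(Z) - X · (∇_Y π)(Z)
+ X · (π(Y)π(Z)) - (-1)^{|X||Y|} Y · (π(X)π(Z))`, where `T` is the torsion of `∇`.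
For `π = g(·, P)`, metric compatibility turns `(∇_X π)(Z)` into `(-1)^{|X||Z|} g(Z, ∇_X P)`, and
passing from the right action to the left one produces the remaining signs.
-/

theorem paritySign_add (i j : ZMod 2) : paritySign (i + j) = paritySign i * paritySign j := by
  revert i j; decide

theorem paritySign_mul_self (i : ZMod 2) : paritySign i * paritySign i = 1 := by
  revert i; decide

theorem paritySign_smul_self_smul {B : Type*} [AddCommGroup B] (i : ZMod 2) (b : B) :
    paritySign i • paritySign i • b = b := by
  rw [smul_smul, paritySign_mul_self, one_smul]

section Superalgebra

variable {A : Type*} [Ring A] [Algebra ℝ A] {𝒜 : ZMod 2 → Submodule ℝ A} [GradedAlgebra 𝒜]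
  [SuperCommutative 𝒜]

namespace SuperDer

theorem part_zero (i : ZMod 2) : part i (0 : SuperDer 𝒜) = 0 :=
  ext_toEnd (map_zero (homPart 𝒜 i))

theorem bracket_zero_left (Y : SuperDer 𝒜) : bracket 0 Y = 0 := by
  refine Finset.sum_eq_zero fun i _ => Finset.sum_eq_zero fun j _ => ext_toEnd ?_
  simp only [part_zero, map_zero, zero_mul, mul_zero, smul_zero, sub_zero]
  rfl

theorem bracket_zero_right (X : SuperDer 𝒜) : bracket X 0 = 0 := by
  refine Finset.sum_eq_zero fun i _ => Finset.sum_eq_zero fun j _ => ext_toEnd ?_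
  simp only [part_zero, map_zero, zero_mul, mul_zero, smul_zero, sub_zero]
  rfl

section HomogeneousSums

variable {B : Type*} [AddCommMonoid B] {x y : ZMod 2} {X Y : SuperDer 𝒜}

theorem HasParity.sum_part_eq (hX : X.HasParity x) (F : ZMod 2 → SuperDer 𝒜 → B)
    (hF : ∀ i, F i 0 = 0) : ∑ i, F i (X.part i) = F x X := by
  rw [Fintype.sum_eq_single x fun i hi => by rw [part_of_hasParity hX, if_neg hi.symm, hF],
    part_of_hasParity hX, if_pos rfl]

theorem HasParity.sum_sum_part_eq (hX : X.HasParity x) (hY : Y.HasParity y)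
    (F : ZMod 2 → ZMod 2 → SuperDer 𝒜 → SuperDer 𝒜 → B)
    (hF_left : ∀ i j V, F i j 0 V = 0) (hF_right : ∀ i j U, F i j U 0 = 0) :
    ∑ i, ∑ j, F i j (X.part i) (Y.part j) = F x y X Y :=
  (hX.sum_part_eq (fun i U => ∑ j, F i j U (Y.part j))
    fun i => Finset.sum_eq_zero fun j _ => hF_left i j _).trans
      (hY.sum_part_eq (fun j V => F x j X V) fun j => hF_right x j X)

end HomogeneousSums

theorem rightMul_sub_right (X : SuperDer 𝒜) (f h : A) :
    X.rightMul (f - h) = X.rightMul f - X.rightMul h :=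
  map_sub (AddMonoidHom.mk' X.rightMul (rightMul_add_right X)) f h

theorem rightMul_sub_left (X Y : SuperDer 𝒜) (f : A) :
    (X - Y).rightMul f = X.rightMul f - Y.rightMul f :=
  map_sub (AddMonoidHom.mk' (fun X : SuperDer 𝒜 => X.rightMul f)
    fun X Y => rightMul_add_left X Y f) X Y

theorem rightMul_zsmul_left (k : ℤ) (X : SuperDer 𝒜) (f : A) :
    (k • X).rightMul f = k • X.rightMul f :=
  map_zsmul (AddMonoidHom.mk' (fun X : SuperDer 𝒜 => X.rightMul f)
    fun X Y => rightMul_add_left X Y f) k X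

end SuperDer

/-- Even one-forms, i.e. those with `|π(Z)| = |Z|`. -/
def IsEvenOneForm (π : SuperDer 𝒜 →ₗ[A] A) : Prop :=
  ∀ (z : ZMod 2) (Z : SuperDer 𝒜), Z.HasParity z → π Z ∈ 𝒜 z

namespace IsEvenOneForm

variable {π : SuperDer 𝒜 →ₗ[A] A} {x y z : ZMod 2} {X Y Z : SuperDer 𝒜}

theorem map_rightMul (hπ : IsEvenOneForm π) (X : SuperDer 𝒜) (f : A) :
    π (X.rightMul f) = π X * f := by
  have swap (i j : ZMod 2) : paritySign (i * j) • (GradedAlgebra.proj 𝒜 j f * π (X.part i)) =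
      π (X.part i) * GradedAlgebra.proj 𝒜 j f :=
    (SuperCommutative.comm (hπ i _ (X.hasParity_part i)) (proj_mem j f)).symm
  simp only [SuperDer.rightMul, map_sum, map_zsmul, map_smul, smul_eq_mul, swap]
  rw [← Finset.sum_mul_sum, ← map_sum, SuperDer.sum_part, sum_proj]

theorem rightMul_mul_eq_smul (hπ : IsEvenOneForm π) (hX : X.HasParity x) (hY : Y.HasParity y)
    (hZ : Z.HasParity z) :
    X.rightMul (π Y * π Z) =
      paritySign (x * y) • paritySign ((x + y) * z) • (π Z • π Y • X) := by
  have hYZ := SetLike.mul_mem_graded (hπ y Y hY) (hπ z Z hZ)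
  rw [SuperDer.rightMul_of_hasParity hX hYZ, SuperCommutative.comm (hπ y Y hY) (hπ z Z hZ),
    smul_assoc, mul_smul, smul_smul, smul_smul (paritySign (x * y))]
  congr 1
  simp only [mul_add, add_mul, paritySign_add, mul_assoc]

end IsEvenOneForm

namespace AffineConnection

variable (D : AffineConnection 𝒜)

theorem map_zero_left (Y : SuperDer 𝒜) : D 0 Y = 0 := by
  simpa using D.add_left 0 0 Y

theorem map_zero_right (X : SuperDer 𝒜) : D X 0 = 0 := by
  simpa using D.add_right X 0 0

theorem map_zsmul_right (X Y : SuperDer 𝒜) (k : ℤ) : D X (k • Y) = k • D X Y :=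
  map_zsmul (AddMonoidHom.mk' (D X) (D.add_right X)) k Y

variable {x y z : ZMod 2} {X Y Z : SuperDer 𝒜}

theorem torsion_of_hasParity (hX : X.HasParity x) (hY : Y.HasParity y) :
    D.torsion X Y = D X Y - paritySign (x * y) • D Y X - X.bracket Y :=
  hX.sum_sum_part_eq hY
    (fun i j U V => D U V - paritySign (i * j) • D V U - U.bracket V)
    (by simp [map_zero_left, map_zero_right, SuperDer.bracket_zero_left])
    (by simp [map_zero_left, map_zero_right, SuperDer.bracket_zero_right])

theorem curvature_of_hasParity (hX : X.HasParity x) (hY : Y.HasParity y) (Z : SuperDer 𝒜) :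
    D.curvature X Y Z =
      D X (D Y Z) - paritySign (x * y) • D Y (D X Z) - D (X.bracket Y) Z :=
  hX.sum_sum_part_eq hY
    (fun i j U V => D U (D V Z) - paritySign (i * j) • D V (D U Z) - D (U.bracket V) Z)
    (by simp [map_zero_left, map_zero_right, SuperDer.bracket_zero_left])
    (by simp [map_zero_left, map_zero_right, SuperDer.bracket_zero_right])

theorem leibniz_rightMul (hX : X.HasParity x) (hY : Y.HasParity y) (f : A) :
    D X (Y.rightMul f) =
      (D X Y).rightMul f + paritySign (x * y) • Y.rightMul (X.toEnd f) := by
  induction f using DirectSum.Decomposition.inductionOn 𝒜 with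
  | zero => simp only [SuperDer.rightMul_zero_right, map_zero, map_zero_right, smul_zero, add_zero]
  | @homogeneous j f =>
    rw [SuperDer.rightMul_of_hasParity hY f.2, map_zsmul_right, D.leibniz hX f.2,
      SuperDer.rightMul_of_hasParity (D.hasParity hX hY) f.2,
      SuperDer.rightMul_of_hasParity hY (hX.1 j f f.2), smul_add, smul_smul, smul_smul, add_comm]
    congr 2
    · exact paritySign_aux y x j
    · rw [mul_add, paritySign_add, mul_comm y x, ← mul_assoc, paritySign_mul_self, one_mul]
  | add f h ihf ihh =>
    simp only [SuperDer.rightMul_add_right, D.add_right, map_add, smul_add, ihf, ihh]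
    abel

/-- The covariant derivative `(∇_X π)(Z)` of an even one-form `π`. For an odd one-form, the second
term would carry the sign `(-1)^{|X|}`. -/
def oneFormDeriv (π : SuperDer 𝒜 →ₗ[A] A) (X Z : SuperDer 𝒜) : A :=
  X.toEnd (π Z) - π (D X Z)

variable {D} {D' : AffineConnection 𝒜} {π : SuperDer 𝒜 →ₗ[A] A}

theorem oneFormDeriv_mem (hπ : IsEvenOneForm π) (hX : X.HasParity x) (hZ : Z.HasParity z) :
    D.oneFormDeriv π X Z ∈ 𝒜 (x + z) :=
  (𝒜 _).sub_mem (hX.1 z _ (hπ z Z hZ)) (hπ _ _ (D.hasParity hX hZ))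

theorem apply_apply_of_eq_add_rightMul (hπ : IsEvenOneForm π)
    (hD' : ∀ X Y, D' X Y = D X Y + X.rightMul (π Y)) (hX : X.HasParity x) (hY : Y.HasParity y)
    (Z : SuperDer 𝒜) :
    D' X (D' Y Z) = D X (D Y Z) + (D X Y).rightMul (π Z)
      + paritySign (x * y) • Y.rightMul (X.toEnd (π Z))
      + X.rightMul (π (D Y Z)) + X.rightMul (π Y * π Z) := by
  rw [hD' X, hD' Y, D.add_right, D.leibniz_rightMul hX hY, map_add, hπ.map_rightMul,
    SuperDer.rightMul_add_right]
  abel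

theorem curvature_of_eq_add_rightMul (hπ : IsEvenOneForm π)
    (hD' : ∀ X Y, D' X Y = D X Y + X.rightMul (π Y)) (hX : X.HasParity x) (hY : Y.HasParity y)
    (Z : SuperDer 𝒜) :
    D'.curvature X Y Z = D.curvature X Y Z + (D.torsion X Y).rightMul (π Z)
      + (paritySign (x * y) • Y.rightMul (D.oneFormDeriv π X Z)
        - X.rightMul (D.oneFormDeriv π Y Z))
      + (X.rightMul (π Y * π Z) - paritySign (x * y) • Y.rightMul (π X * π Z)) := by
  rw [D'.curvature_of_hasParity hX hY, D.curvature_of_hasParity hX hY,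
    D.torsion_of_hasParity hX hY, apply_apply_of_eq_add_rightMul hπ hD' hX hY,
    apply_apply_of_eq_add_rightMul hπ hD' hY hX, hD' (X.bracket Y), mul_comm y x]
  simp only [oneFormDeriv, SuperDer.rightMul_sub_left, SuperDer.rightMul_sub_right,
    SuperDer.rightMul_zsmul_left, smul_add, smul_sub, paritySign_smul_self_smul]
  abel

variable {d : ZMod 2} {g : SuperMetric 𝒜 d}

theorem MetricCompatible.oneFormDeriv_oneForm (hD : D.MetricCompatible g) (P : SuperDer 𝒜)
    (hX : X.HasParity x) (hZ : Z.HasParity z) :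
    D.oneFormDeriv (g.oneForm P) X Z = paritySign (x * z) • g Z (D X P) :=
  sub_eq_of_eq_add' (hD hX hZ P)

theorem MetricCompatible.rightMul_oneFormDeriv_oneForm (hD : D.MetricCompatible g)
    {P : SuperDer 𝒜} (hπ : IsEvenOneForm (g.oneForm P)) (hX : X.HasParity x) (hY : Y.HasParity y)
    (hZ : Z.HasParity z) :
    Y.rightMul (D.oneFormDeriv (g.oneForm P) X Z) =
      paritySign (x * y) • paritySign ((x + y) * z) • (g Z (D X P) • Y) := by
  rw [SuperDer.rightMul_of_hasParity hY (oneFormDeriv_mem hπ hX hZ),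
    hD.oneFormDeriv_oneForm P hX hZ, smul_assoc, smul_smul, smul_smul]
  congr 1
  rw [mul_add, add_mul, paritySign_add, paritySign_add, mul_comm y x, mul_assoc,
    mul_comm (paritySign (y * z))]

end AffineConnection

theorem proposition2p15_general {d p : ZMod 2} (g : SuperMetric 𝒜 d) {P : SuperDer 𝒜}
    (hP : P.HasParity p) (hgP : d + p = 0) {D : AffineConnection 𝒜} (hD : D.MetricCompatible g) :
    IsEvenOneForm (g.oneForm P) ∧
    ∀ (x y z : ZMod 2) (X Y Z : SuperDer 𝒜), X.HasParity x → Y.HasParity y → Z.HasParity z →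
      (semiSymmetricNonMetric D g P hP hgP).curvature X Y Z =
        D.curvature X Y Z
        + paritySign ((x + y) * z) • (g Z (D X P) • Y - paritySign (x * y) • (g Z (D Y P) • X))
        + paritySign ((x + y) * z) • (g.oneForm P Z •
            (paritySign (x * y) • (g.oneForm P Y • X) - g.oneForm P X • Y))
        + (D.torsion X Y).rightMul (g.oneForm P Z) := by
  have hπ : IsEvenOneForm (g.oneForm P) := fun _ _ => g.oneForm_mem hP hgP
  refine ⟨hπ, fun x y z X Y Z hX hY hZ => ?_⟩
  rw [AffineConnection.curvature_of_eq_add_rightMul hπ (fun _ _ => rfl) hX hY,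
    hD.rightMul_oneFormDeriv_oneForm hπ hX hY hZ, hD.rightMul_oneFormDeriv_oneForm hπ hY hX hZ,
    hπ.rightMul_mul_eq_smul hX hY hZ, hπ.rightMul_mul_eq_smul hY hX hZ, mul_comm y x, add_comm y x]
  simp only [smul_sub, paritySign_smul_self_smul, smul_comm (g.oneForm P Z) (paritySign (x * y)),
    smul_comm (paritySign ((x + y) * z)) (paritySign (x * y))]
  abel

end Superalgebra

theorem proposition2p15 {m n : ℕ} (M : Supermanifold m n) (g : SuperRiemannianMetric M)
    -- the vector field `P`, with `|g| + |P| = 0`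
    (p : ZMod 2) (P : M.Vect ⊤) (hP : P.HasParity p) (hgP : g.parity + p = 0)
    -- the Levi-Civita connection
    (nablaL : AffineConnection (M.grading ⊤)) (hL : nablaL.IsLeviCivita g.globally) :
    -- the one-form `π(Z) = g(Z, P)` is even
    (∀ (z : ZMod 2) (Z : M.Vect ⊤), Z.HasParity z → g.globally.oneForm P Z ∈ M.grading ⊤ z) ∧
    -- the curvature of the semi-symmetric non-metric connection
    ∀ (x y z : ZMod 2) (X Y Z : M.Vect ⊤), X.HasParity x → Y.HasParity y → Z.HasParity z →
      (semiSymmetricNonMetric nablaL g.globally P hP hgP).curvature X Y Z =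
        nablaL.curvature X Y Z
        + paritySign ((x + y) * z) • (g.globally Z (nablaL X P) • Y
            - paritySign (x * y) • (g.globally Z (nablaL Y P) • X))
        + paritySign ((x + y) * z) • (g.globally.oneForm P Z •
            (paritySign (x * y) • (g.globally.oneForm P Y • X) - g.globally.oneForm P X • Y)) := by
  simpa only [IsEvenOneForm, hL.torsion_eq_zero, SuperDer.rightMul_zero_left, add_zero] using
    proposition2p15_general g.globally hP hgP hL.metricCompatible
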